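/- Let $R$ be an associative ring with unity and let $\sigma$ be an automorphism of $R$. Let $R[x;\sigma]$ be the skew polynomial ring, whose elements are the polynomials $\sum_i a_i x^i$ with coefficients $a_i\in R$ written on the left and whose multiplication is determined by $xr=\sigma(r)x$ for $r\in R$. A ring is called right quasi-duo if each of its maximal right ideals is a two-sided ideal. Denote by $J(\cdot)$ the Jacobson radical and by $\mathcal N(R)$ the nil radical of $R$, i.e. the sum of all nil two-sided ideals of $R$; for an ideal $I$ of $R$ let $I[x;\sigma]$ be the set of all skew polynomials whose coefficients all lie in $I$. Suppose that $R$ is left noetherian or right noetherian, or that $\sigma$ is of locally finite order (for every $a\in R$ there is $n\ge 1$ with $\sigma^n(a)=a$). Then $R[x;\sigma]$ is right quasi-duo if and only if the following three conditions hold together: $J(R[x;\sigma])=\mathcal N(R)[x;\sigma]$; the ring $R/\mathcal N(R)$ is commutative; and the automorphism of $R/\mathcal N(R)$ induced by $\sigma$ is the identity. -/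

import Mathlib

/-- A ring `T` is right quasi-duo if every maximal right ideal of `T` (a maximal proper
submodule of `T` as a right module over itself) is a two-sided ideal. -/
def IsRightQuasiDuo (T : Type*) [Ring T] : Prop :=
  ∀ M : Submodule Tᵐᵒᵖ T, IsCoatom M → ∀ t a : T, a ∈ M → t * a ∈ M

/-- The nil radical of a ring: the sum of all nil two-sided ideals. -/
def nilRadical (R : Type*) [Ring R] : Ideal R :=
  sSup {I : Ideal R | I.IsTwoSided ∧ ∀ a ∈ I, IsNilpotent a}

instance nilRadical_isTwoSided (R : Type*) [Ring R] : (nilRadical R).IsTwoSided where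
  mul_mem_of_left {a} b ha := by
    let f : R →ₗ[R] R := LinearMap.toSpanSingleton R R b
    suffices h : nilRadical R ≤ Submodule.comap f (nilRadical R) from h ha
    refine sSup_le fun I hI x hx => ?_
    have := hI.1
    exact (le_sSup hI : I ≤ nilRadical R) (I.mul_mem_right b hx)

theorem nilRadical_le_comap {R : Type*} [Ring R] (σ : R ≃+* R) :
    nilRadical R ≤ (nilRadical R).comap (σ : R →+* R) := by
  refine sSup_le fun I hI x hx => ?_
  have := hI.1
  have hJ : I.comap (σ.symm : R →+* R) ≤ nilRadical R := by
    refine le_sSup ⟨inferInstance, fun a ha => ?_⟩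
    obtain ⟨n, hn⟩ := hI.2 _ ha
    exact ⟨n, σ.symm.injective (by simpa using hn)⟩
  exact hJ (by simpa [Ideal.mem_comap] using hx)

theorem nilRadical_eq_map {R : Type*} [Ring R] (σ : R ≃+* R) :
    nilRadical R = (nilRadical R).map (σ : R →+* R) := by
  refine le_antisymm (fun x hx => ?_) (Ideal.map_le_iff_le_comap.2 (nilRadical_le_comap σ))
  have hy : σ.symm x ∈ nilRadical R := nilRadical_le_comap σ.symm hx
  simpa using Ideal.mem_map_of_mem (σ : R →+* R) hy

/-- The automorphism of `R ⧸ nilRadical R` induced by an automorphism `σ` of `R`. -/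
def nilRadicalQuotientAut {R : Type*} [Ring R] (σ : R ≃+* R) :
    (R ⧸ nilRadical R) ≃+* (R ⧸ nilRadical R) :=
  Ideal.quotientEquiv (nilRadical R) (nilRadical R) σ (nilRadical_eq_map σ)

/-- The action of the monoid `ℕ` on `R` in which `n` acts as the `n`-th power of `σ`. -/
abbrev powersAction {R : Type*} [Ring R] (σ : R ≃+* R) :
    MulSemiringAction (Multiplicative ℕ) R :=
  MulSemiringAction.compHom R (powersHom (RingAut R) σ)

/-- The skew polynomial ring `R[x;σ]`: polynomials `∑ aₙ xⁿ` with coefficients on the left,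
multiplied according to `x * r = σ r * x`. -/
def SkewPoly (R : Type*) [Ring R] (_σ : R ≃+* R) : Type _ := SkewPolynomial R

noncomputable instance (R : Type*) [Ring R] (σ : R ≃+* R) : Ring (SkewPoly R σ) :=
  letI := powersAction σ
  inferInstanceAs (Ring (SkewPolynomial R))

/-- The `n`-th (left) coefficient of a skew polynomial. -/
def SkewPoly.coeff {R : Type*} [Ring R] {σ : R ≃+* R} (f : SkewPoly R σ) (n : ℕ) : R :=
  SkewPolynomial.coeff (R := R) f n

/-- For an ideal `I` of `R`, the set `I[x;σ]` of the skew polynomials all of whose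
coefficients lie in `I`. -/
def SkewPoly.withCoeffsIn {R : Type*} [Ring R] (σ : R ≃+* R) (I : Ideal R) :
    Set (SkewPoly R σ) :=
  {f | ∀ n : ℕ, f.coeff n ∈ I}

/-- `σ` is of locally finite order: for every `a` there is `n ≥ 1` with `σⁿ a = a`. -/
def IsLocallyFiniteOrder {R : Type*} [Ring R] (σ : R ≃+* R) : Prop :=
  ∀ a : R, ∃ n : ℕ, 1 ≤ n ∧ σ^[n] a = a

/-! Write T = R[x;σ] and N for the nil radical of R. If T is right quasi-duo, its maximal right
ideals M are completely prime. When x ∉ M, the constants of M form a σ-stable completely prime ideal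
Q, and a degree count modulo Q puts every f that is nonconstant modulo Q in a maximal right ideal
containing Q (`exists_isCoatom_mem`). Applied to 1 - c x with c ∉ Q, this enlarges Q to a Q' that
still misses c but contains every c σ(y) - y c. Repeating this forces all commutators and all σ(y) -
y into every Q (`commutator_mem`, `map_sub_mem`).

Let I be the intersection of all Q. For a ∈ I and k ≥ 1, no maximal right ideal contains 1 - a x^k,
so it has a right inverse. Among the coefficients of that inverse are the products a σ^k(a)
σ^{2k}(a)⋯, so these vanish eventually. The hypothesis on R or σ then yields I ≤ N, from which the
three conditions follow.

Conversely, the three conditions put every commutator of T in J(T), hence in every maximal right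
ideal. -/

namespace SkewPoly

/-! ### Coefficient calculus in skew polynomial rings. -/

variable {R : Type*} [Ring R] {σ : R ≃+* R}

@[ext] theorem ext {f g : SkewPoly R σ} (h : ∀ n, f.coeff n = g.coeff n) : f = g :=
  SkewMonoidAlgebra.ext fun n => h n.toAdd

theorem coeff_add (f g : SkewPoly R σ) (n : ℕ) : (f + g).coeff n = f.coeff n + g.coeff n := by
  let := powersAction σ
  exact congrArg (fun p => p (Multiplicative.ofAdd n)) (SkewMonoidAlgebra.coeff_add f g)

@[simp] theorem coeff_zero (n : ℕ) : (0 : SkewPoly R σ).coeff n = 0 := rfl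

theorem coeff_neg (f : SkewPoly R σ) (n : ℕ) : (-f).coeff n = -f.coeff n :=
  eq_neg_of_add_eq_zero_left (by rw [← coeff_add]; simp)

theorem coeff_sub (f g : SkewPoly R σ) (n : ℕ) : (f - g).coeff n = f.coeff n - g.coeff n := by
  rw [sub_eq_add_neg, coeff_add, coeff_neg, sub_eq_add_neg]

theorem exists_coeff_eq_zero (f : SkewPoly R σ) : ∃ N, ∀ n, N ≤ n → f.coeff n = 0 := by
  refine ⟨(SkewPolynomial.support (R := R) f).sup id + 1, fun n hn => ?_⟩
  by_contra hne
  have := Finset.le_sup (f := id) (SkewPolynomial.mem_support_iff.2 hne)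
  simp only [id] at this
  omega

/-- The skew monomial `a xⁿ`. -/
noncomputable def monomial (σ : R ≃+* R) (n : ℕ) (a : R) : SkewPoly R σ :=
  SkewPolynomial.monomial n a

theorem coeff_monomial (n m : ℕ) (a : R) :
    (monomial σ n a).coeff m = if n = m then a else 0 :=
  SkewPolynomial.coeff_monomial

theorem powersAction_smul (n : ℕ) (a : R) :
    letI := powersAction σ
    Multiplicative.ofAdd n • a = σ^[n] a := by
  change ((powersHom (RingAut R) σ) (Multiplicative.ofAdd n)) a = _
  rw [powersHom_apply, toAdd_ofAdd]
  induction n with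
  | zero => rfl
  | succ n ih => rw [pow_succ', Function.iterate_succ_apply', ← ih]; rfl

theorem monomial_mul_monomial (n m : ℕ) (a b : R) :
    monomial σ n a * monomial σ m b = monomial σ (n + m) (a * σ^[n] b) := by
  let := powersAction σ
  rw [← powersAction_smul, ← SkewPolynomial.φ_iterate_apply]
  exact SkewPolynomial.monomial_mul_monomial n m a b

theorem monomial_add (n : ℕ) (a b : R) :
    monomial σ n (a + b) = monomial σ n a + monomial σ n b := by
  ext m
  rw [coeff_add]
  simp only [coeff_monomial]
  split <;> simp

theorem coeff_sum {ι : Type*} (s : Finset ι) (f : ι → SkewPoly R σ) (n : ℕ) :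
    (∑ i ∈ s, f i).coeff n = ∑ i ∈ s, (f i).coeff n :=
  map_sum (AddMonoidHom.mk' (fun f : SkewPoly R σ => f.coeff n) fun f g => coeff_add f g n) f s

theorem eq_sum_monomial (f : SkewPoly R σ) :
    ∃ N, f = ∑ i ∈ Finset.range N, monomial σ i (f.coeff i) := by
  obtain ⟨N, hN⟩ := exists_coeff_eq_zero f
  refine ⟨N, ext fun n => ?_⟩
  rw [coeff_sum]
  simp only [coeff_monomial, Finset.sum_ite_eq', Finset.mem_range]
  split_ifs with h
  · rfl
  · exact hN n (not_lt.1 h)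

theorem induction {P : SkewPoly R σ → Prop} (h0 : P 0) (hadd : ∀ f g, P f → P g → P (f + g))
    (hmon : ∀ n a, P (monomial σ n a)) (f : SkewPoly R σ) : P f := by
  obtain ⟨N, hN⟩ := eq_sum_monomial f
  rw [hN]
  exact Finset.sum_induction _ P hadd h0 fun i _ => hmon i _

theorem coeff_mul (f g : SkewPoly R σ) (n : ℕ) :
    (f * g).coeff n =
      ∑ p ∈ Finset.HasAntidiagonal.antidiagonal n, f.coeff p.1 * σ^[p.1] (g.coeff p.2) := by
  induction f using induction with
  | h0 => simp
  | hadd f₁ f₂ h₁ h₂ =>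
    simp only [add_mul, coeff_add, h₁, h₂, Finset.sum_add_distrib]
  | hmon i a =>
    induction g using induction with
    | h0 => simp
    | hadd g₁ g₂ h₁ h₂ =>
      simp only [mul_add, coeff_add, h₁, h₂, iterate_map_add, Finset.sum_add_distrib]
    | hmon j b =>
      rw [monomial_mul_monomial]
      simp only [coeff_monomial]
      split_ifs with h
      · rw [Finset.sum_eq_single (i, j)]
        · simp
        · rintro ⟨p, q⟩ - hne
          by_cases hp : i = p
          · have : j ≠ q := fun hq => hne (by rw [hp, hq])
            simp [this]
          · simp [hp]
        · intro hn
          exact absurd (Finset.HasAntidiagonal.mem_antidiagonal.2 h) hn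
      · refine (Finset.sum_eq_zero ?_).symm
        rintro ⟨p, q⟩ hpq
        rw [Finset.HasAntidiagonal.mem_antidiagonal] at hpq
        by_cases hp : i = p
        · have : j ≠ q := fun hq => h (by simpa [hp, hq] using hpq)
          simp [this]
        · simp [hp]

theorem one_eq_monomial : (1 : SkewPoly R σ) = monomial σ 0 1 := by
  let := powersAction σ
  rfl

theorem coeff_one (n : ℕ) : (1 : SkewPoly R σ).coeff n = if 0 = n then 1 else 0 := by
  rw [one_eq_monomial, coeff_monomial]

/-- The embedding of the coefficient ring as the constant skew polynomials. -/
noncomputable def C (σ : R ≃+* R) : R →+* SkewPoly R σ where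
  toFun a := monomial σ 0 a
  map_one' := one_eq_monomial.symm
  map_mul' a b := by simp [monomial_mul_monomial]
  map_zero' := by ext n; simp [coeff_monomial]
  map_add' a b := monomial_add 0 a b

/-- The indeterminate of the skew polynomial ring. -/
noncomputable def X (σ : R ≃+* R) : SkewPoly R σ := monomial σ 1 1

theorem C_apply (a : R) : C σ a = monomial σ 0 a := rfl

theorem X_mul_C (a : R) : X σ * C σ a = C σ (σ a) * X σ := by
  simp [X, C_apply, monomial_mul_monomial]

theorem X_pow (n : ℕ) : X σ ^ n = monomial σ n 1 := by
  induction n with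
  | zero => exact one_eq_monomial
  | succ n ih => rw [pow_succ, ih, X, monomial_mul_monomial, iterate_map_one, mul_one]

theorem C_mul_X_pow (n : ℕ) (a : R) : C σ a * X σ ^ n = monomial σ n a := by
  simp [X_pow, C_apply, monomial_mul_monomial]

theorem coeff_mul_X (f : SkewPoly R σ) (n : ℕ) : (f * X σ).coeff (n + 1) = f.coeff n := by
  rw [coeff_mul, Finset.sum_eq_single (n, 1)]
  · simp [X, coeff_monomial]
  · rintro ⟨p, q⟩ hpq hne
    rw [Finset.HasAntidiagonal.mem_antidiagonal] at hpq
    have : 1 ≠ q := fun hq => hne (by ext <;> simp at hpq ⊢ <;> omega)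
    simp [X, coeff_monomial, this]
  · intro hn
    exact absurd (Finset.HasAntidiagonal.mem_antidiagonal.2 (by rfl)) hn

/-- A right ideal that contains all the coefficients of `f` contains `f`. -/
theorem mem_of_coeff_mem {M : Submodule (SkewPoly R σ)ᵐᵒᵖ (SkewPoly R σ)} {f : SkewPoly R σ}
    (h : ∀ n, C σ (f.coeff n) ∈ M) : f ∈ M := by
  obtain ⟨N, hN⟩ := eq_sum_monomial f
  rw [hN]
  refine sum_mem fun i _ => ?_
  rw [← C_mul_X_pow]
  exact M.smul_mem (MulOpposite.op _) (h i)

end SkewPoly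
-- Maximal right ideals, the Jacobson radical and quasi-duo rings.
section RightIdeals

variable {T : Type*} [Ring T]

theorem mul_mem_of_mem_right_ideal (M : Submodule Tᵐᵒᵖ T) {a : T} (ha : a ∈ M) (t : T) :
    a * t ∈ M :=
  M.smul_mem (MulOpposite.op t) ha

theorem right_ideal_eq_top_of_one_mem {M : Submodule Tᵐᵒᵖ T} (h : (1 : T) ∈ M) : M = ⊤ :=
  eq_top_iff.2 fun t _ => by simpa using mul_mem_of_mem_right_ideal M h t

theorem exists_isCoatom_right_ideal_le {N : Submodule Tᵐᵒᵖ T} (h : (1 : T) ∉ N) :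
    ∃ M : Submodule Tᵐᵒᵖ T, IsCoatom M ∧ N ≤ M := by
  have hspan : Submodule.span Tᵐᵒᵖ {(1 : T)} = ⊤ :=
    right_ideal_eq_top_of_one_mem (Submodule.mem_span_singleton_self 1)
  have hfin : Module.Finite Tᵐᵒᵖ T := Module.finite_def.2 (hspan ▸ Submodule.fg_span_singleton 1)
  obtain h' | h' := eq_top_or_exists_le_coatom N
  · exact absurd (h' ▸ Submodule.mem_top) h
  · exact h'

theorem one_notMem_of_isCoatom {M : Submodule Tᵐᵒᵖ T} (hM : IsCoatom M) : (1 : T) ∉ M :=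
  fun h => hM.1 (right_ideal_eq_top_of_one_mem h)

theorem exists_mul_sub_one_mem_of_isCoatom {M : Submodule Tᵐᵒᵖ T} (hM : IsCoatom M) {a : T}
    (ha : a ∉ M) : ∃ t, a * t - 1 ∈ M := by
  have htop : M ⊔ Submodule.span Tᵐᵒᵖ {a} = ⊤ := by
    refine hM.2 _ (lt_of_le_of_ne le_sup_left fun h => ha ?_)
    rw [h]
    exact Submodule.mem_sup_right (Submodule.mem_span_singleton_self a)
  obtain ⟨m, hm, s, hs, hms⟩ := Submodule.mem_sup.1 (htop ▸ Submodule.mem_top : (1 : T) ∈ _)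
  obtain ⟨t, rfl⟩ := Submodule.mem_span_singleton.1 hs
  refine ⟨t.unop, ?_⟩
  have : a * t.unop - 1 = -m := by rw [← hms, MulOpposite.smul_eq_mul_unop]; abel
  rw [this]
  exact neg_mem hm

theorem exists_right_inverse_of_forall_notMem {a : T}
    (h : ∀ M : Submodule Tᵐᵒᵖ T, IsCoatom M → a ∉ M) : ∃ t, a * t = 1 := by
  by_contra! hne
  obtain ⟨M, hM, hle⟩ := exists_isCoatom_right_ideal_le (N := Submodule.span Tᵐᵒᵖ {a}) (by
    intro h1
    obtain ⟨t, ht⟩ := Submodule.mem_span_singleton.1 h1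
    exact hne t.unop ht)
  exact h M hM (hle (Submodule.mem_span_singleton_self a))

/-- The Jacobson radical is the intersection of the maximal right ideals. -/
theorem mem_jacobson_iff_forall_right_ideal {f : T} :
    f ∈ Ring.jacobson T ↔ ∀ M : Submodule Tᵐᵒᵖ T, IsCoatom M → f ∈ M := by
  constructor
  · intro hf M hM
    by_contra hfM
    obtain ⟨s, hs⟩ := exists_mul_sub_one_mem_of_isCoatom hM hfM
    have inv : ∀ y ∈ Ring.jacobson T, ∃ z, z * (1 - y) = 1 := fun y hy => by
      rw [← Ideal.jacobson_bot] at hy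
      obtain ⟨z, hz⟩ := Ideal.mem_jacobson_iff.1 (neg_mem hy) 1
      refine ⟨z, sub_eq_zero.1 ?_⟩
      rw [← Ideal.mem_bot.1 hz]
      noncomm_ring
    have hfs : f * s ∈ Ring.jacobson T := Ideal.mul_mem_right _ _ hf
    obtain ⟨z, hz⟩ := inv _ hfs
    obtain ⟨w, hw⟩ := inv (-(z * (f * s))) (neg_mem (Ideal.mul_mem_left _ z hfs))
    -- The left inverse z of 1 - f s is itself of the form 1 - y with y in the radical, so it has a
    -- left inverse too and is a unit.
    have hz' : 1 - -(z * (f * s)) = z := by rw [← hz]; noncomm_ring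
    rw [hz'] at hw
    have hu : (1 - f * s) * z = 1 := by
      rwa [left_inv_eq_right_inv hw hz] at hw
    refine one_notMem_of_isCoatom hM ?_
    rw [← hu]
    refine mul_mem_of_mem_right_ideal M ?_ z
    rw [← neg_sub]
    exact neg_mem hs
  · intro hf
    have inv : ∀ y, ∃ v, (1 + f * y) * v = 1 := fun y =>
      exists_right_inverse_of_forall_notMem fun M hM h => one_notMem_of_isCoatom hM (by
        simpa using sub_mem h (mul_mem_of_mem_right_ideal M (hf M hM) y))
    rw [← Ideal.jacobson_bot, Ideal.mem_jacobson_iff]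
    intro y
    obtain ⟨v, hv⟩ := inv y
    obtain ⟨w, hw⟩ := inv (-(y * v))
    have hv' : 1 + f * -(y * v) = v := by rw [← hv]; noncomm_ring
    rw [hv'] at hw
    have hvl : v * (1 + f * y) = 1 := by rwa [← left_inv_eq_right_inv hv hw] at hw
    -- Inverting 1 + f y by v makes 1 - y v f a left inverse of 1 + y f; this carries right inverses
    -- over to the left-handed criterion.
    refine ⟨1 - y * v * f, ?_⟩
    rw [Ideal.mem_bot]
    calc (1 - y * v * f) * y * f + (1 - y * v * f) - 1
        = y * f - y * (v * (1 + f * y)) * f := by noncomm_ring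
      _ = 0 := by rw [hvl]; noncomm_ring

/-- An element b outside M is right invertible modulo M, and since M is two-sided this inverse
cancels b from a b. -/
theorem IsRightQuasiDuo.mem_or_mem (hT : IsRightQuasiDuo T) {M : Submodule Tᵐᵒᵖ T}
    (hM : IsCoatom M) {a b : T} (h : a * b ∈ M) : a ∈ M ∨ b ∈ M := by
  by_contra! hab
  obtain ⟨s, hs⟩ := exists_mul_sub_one_mem_of_isCoatom hM hab.2
  refine hab.1 ?_
  have := sub_mem (mul_mem_of_mem_right_ideal M h s) (hT M hM a _ hs)
  rwa [mul_sub, mul_one, mul_assoc, sub_sub_cancel] at this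

theorem IsRightQuasiDuo.mem_of_isNilpotent (hT : IsRightQuasiDuo T) {M : Submodule Tᵐᵒᵖ T}
    (hM : IsCoatom M) {a : T} (h : IsNilpotent a) : a ∈ M := by
  obtain ⟨n, hn⟩ := h
  have key : ∀ n, a ^ n ∈ M → a ∈ M := by
    intro n
    induction n with
    | zero => intro h; exact absurd (by simpa using h) (one_notMem_of_isCoatom hM)
    | succ n ih => intro h; exact (hT.mem_or_mem hM (pow_succ a n ▸ h)).elim ih id
  exact key n (hn ▸ zero_mem M)

end RightIdeals

/-! ### The nil radical and twisted powers. -/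

section NilRadical

variable {R : Type*} [Ring R]

theorem le_nilRadical {I : Ideal R} [I.IsTwoSided] (h : ∀ a ∈ I, IsNilpotent a) :
    I ≤ nilRadical R :=
  le_sSup ⟨‹_›, h⟩

theorem isNilpotent_of_mem_nilRadical {a : R} (ha : a ∈ nilRadical R) : IsNilpotent a := by
  rw [nilRadical, Submodule.mem_sSup_of_directed] at ha
  · obtain ⟨I, hI, haI⟩ := ha
    exact hI.2 a haI
  · refine ⟨⊥, inferInstance, fun a ha => ?_⟩
    rw [Ideal.mem_bot.1 ha]
    exact IsNilpotent.zero
  · rintro (I : Ideal R) ⟨hI, hIn⟩ (J : Ideal R) ⟨hJ, hJn⟩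
    refine ⟨I ⊔ J, ⟨⟨fun {x} b hx => ?_⟩, fun x hx => ?_⟩, le_sup_left, le_sup_right⟩
    · obtain ⟨i, hi, j, hj, rfl⟩ := Submodule.mem_sup.1 hx
      rw [add_mul]
      exact add_mem (Submodule.mem_sup_left (I.mul_mem_right b hi))
        (Submodule.mem_sup_right (J.mul_mem_right b hj))
    · obtain ⟨i, hi, j, hj, rfl⟩ := Submodule.mem_sup.1 hx
      obtain ⟨n, hn⟩ := hIn i hi
      -- Modulo J the power is i ^ n = 0.
      have hmem : (i + j) ^ n ∈ J := by
        rw [← Ideal.Quotient.eq_zero_iff_mem, map_pow, map_add,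
          Ideal.Quotient.eq_zero_iff_mem.2 hj, add_zero, ← map_pow, hn, map_zero]
      obtain ⟨m, hm⟩ := hJn _ hmem
      exact ⟨n * m, by rw [pow_mul, hm]⟩

/-- Semiprimeness of R/N: the two-sided ideal generated by a has square inside N, so it is nil. -/
theorem mem_nilRadical_of_forall_mul_mul_mem {a : R} (h : ∀ t, a * t * a ∈ nilRadical R) :
    a ∈ nilRadical R := by
  set N := nilRadical R
  let B : Ideal R := Ideal.span (Set.range fun r => a * r)
  have hB : B.IsTwoSided := by
    constructor
    intro x b hx
    induction hx using Submodule.span_induction with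
    | mem x hx =>
      obtain ⟨r, rfl⟩ := hx
      exact Ideal.subset_span ⟨r * b, (mul_assoc _ _ _).symm⟩
    | zero => simp
    | add x y _ _ hx hy => rw [add_mul]; exact add_mem hx hy
    | smul c x _ hx => rw [smul_eq_mul, mul_assoc]; exact B.mul_mem_left c hx
  have hBa : ∀ y ∈ B, ∀ t, a * t * y ∈ N := by
    intro y hy
    induction hy using Submodule.span_induction with
    | mem x hx =>
      obtain ⟨r, rfl⟩ := hx
      intro t
      rw [← mul_assoc]
      exact N.mul_mem_right r (h t)
    | zero => simp
    | add x y _ _ hx hy => intro t; rw [mul_add]; exact add_mem (hx t) (hy t)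
    | smul c x _ hx => intro t; rw [smul_eq_mul, ← mul_assoc, mul_assoc a]; exact hx _
  have hBB : ∀ x ∈ B, ∀ y ∈ B, x * y ∈ N := by
    intro x hx y hy
    induction hx using Submodule.span_induction with
    | mem x hx => obtain ⟨r, rfl⟩ := hx; exact hBa y hy r
    | zero => simp
    | add x z _ _ hx hz => rw [add_mul]; exact add_mem hx hz
    | smul c x _ hx => rw [smul_eq_mul, mul_assoc]; exact N.mul_mem_left c hx
  have hnil : ∀ x ∈ B, IsNilpotent x := fun x hx => by
    obtain ⟨n, hn⟩ := isNilpotent_of_mem_nilRadical (hBB x hx x hx)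
    exact ⟨2 * n, by rw [pow_mul, pow_two, hn]⟩
  exact le_nilRadical hnil (Ideal.subset_span ⟨1, mul_one a⟩)

theorem map_mem_nilRadical_iff (σ : R ≃+* R) {a : R} :
    σ a ∈ nilRadical R ↔ a ∈ nilRadical R :=
  ⟨fun h => by simpa using nilRadical_le_comap σ.symm h, fun h => nilRadical_le_comap σ h⟩

theorem iterate_mem_nilRadical_iff (σ : R ≃+* R) (n : ℕ) {a : R} :
    σ^[n] a ∈ nilRadical R ↔ a ∈ nilRadical R := by
  induction n with
  | zero => rfl
  | succ n ih => rw [Function.iterate_succ_apply', map_mem_nilRadical_iff, ih]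

/-- The product `a φ(a) φ²(a) ⋯ φⁿ⁻¹(a)`. -/
def twistedPow (φ : R → R) (a : R) : ℕ → R
  | 0 => 1
  | n + 1 => a * φ (twistedPow φ a n)

/-- Peels off the last factor instead of the first, as the right noetherian argument needs. -/
theorem twistedPow_succ' (σ : R ≃+* R) (k : ℕ) (a : R) (n : ℕ) :
    twistedPow σ^[k] a (n + 1) = twistedPow σ^[k] a n * σ^[k * n] a := by
  induction n with
  | zero => simp [twistedPow]
  | succ n ih =>
    rw [twistedPow, ih, iterate_map_mul, ← mul_assoc, ← Function.iterate_add_apply, ← twistedPow.eq_2,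
      Nat.mul_succ, add_comm k, ← ih]

theorem twistedPow_of_fixed {φ : R → R} {a : R} (hφ : ∀ n, φ (a ^ n) = a ^ n) (n : ℕ) :
    twistedPow φ a n = a ^ n := by
  induction n with
  | zero => simp [twistedPow]
  | succ n ih => rw [twistedPow, ih, hφ, pow_succ']

/-! ### From vanishing twisted powers to the nil radical. -/

theorem exists_mem_span_of_isNoetherian (S : Type*) {M : Type*} [Ring S] [AddCommGroup M]
    [Module S M] [IsNoetherian S M] (v : ℕ → M) :
    ∃ n, v n ∈ Submodule.span S (v '' Set.Iio n) := by
  let L : ℕ →o Submodule S M :=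
    ⟨fun n => Submodule.span S (v '' Set.Iio n), fun m n h =>
      Submodule.span_mono (Set.image_mono (Set.Iio_subset_Iio h))⟩
  obtain ⟨n, hn⟩ := monotone_stabilizes_iff_noetherian.2 ‹_› L
  refine ⟨n, ?_⟩
  have : L n = L (n + 1) := hn (n + 1) n.le_succ
  change v n ∈ L n
  rw [this]
  exact Submodule.subset_span ⟨n, n.lt_succ_self, rfl⟩

/-- If `R` is left or right noetherian (`S = R` or `S = Rᵐᵒᵖ`) and `a R σᵏ(a) ⊆ N` for all
`k ≥ 1`, where `N` is the nil radical, then `a ∈ N`. -/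
theorem mem_nilRadical_of_forall_mul_iterate_mem (S : Type*) [Ring S] [Module S R]
    [IsNoetherian S R] (hS : ∀ (s : S) (x : R), (∃ r, s • x = r * x) ∨ ∃ r, s • x = x * r)
    (σ : R ≃+* R) {a : R} (h : ∀ k, 1 ≤ k → ∀ t, a * t * σ^[k] a ∈ nilRadical R) :
    a ∈ nilRadical R := by
  set N := nilRadical R
  obtain ⟨n, hn⟩ := exists_mem_span_of_isNoetherian S fun j => σ^[j] a
  -- For j < n, applying σ^j to the hypothesis with k = n - j gives σ^j(a) R σ^n(a) ⊆ N; this passes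
  -- to the span, which contains σ^n(a).
  have key : ∀ y ∈ Submodule.span S ((fun j => σ^[j] a) '' Set.Iio n),
      ∀ t, y * t * σ^[n] a ∈ N := by
    intro y hy
    induction hy using Submodule.span_induction with
    | mem x hx =>
      obtain ⟨j, hj, rfl⟩ := hx
      intro t
      obtain ⟨s, rfl⟩ := σ.surjective.iterate j t
      have hj : j < n := hj
      obtain ⟨k, rfl⟩ := Nat.exists_eq_add_of_lt hj
      have : j + k + 1 = j + (k + 1) := rfl
      dsimp only
      rw [this, Function.iterate_add_apply, ← iterate_map_mul, ← iterate_map_mul]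
      exact (iterate_mem_nilRadical_iff σ j).2 (h (k + 1) k.succ_pos s)
    | zero => simp
    | add x y _ _ hx hy => intro t; rw [add_mul, add_mul]; exact add_mem (hx t) (hy t)
    | smul c x _ hx =>
      intro t
      obtain ⟨r, hr⟩ | ⟨r, hr⟩ := hS c x
      · rw [hr, mul_assoc, mul_assoc, ← mul_assoc x]
        exact N.mul_mem_left r (hx t)
      · rw [hr, mul_assoc x]
        exact hx _
  refine mem_nilRadical_of_forall_mul_mul_mem fun t => ?_
  have := key _ hn (σ^[n] t)
  rw [← iterate_map_mul, ← iterate_map_mul] at this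
  exact (iterate_mem_nilRadical_iff σ n).1 this

theorem exists_twistedPow_boundary {φ : R → R} {e : R} {n : ℕ} {N : Ideal R}
    (h : twistedPow φ e n ∈ N) (h1 : (1 : R) ∉ N) :
    ∃ m, twistedPow φ e m ∉ N ∧ twistedPow φ e (m + 1) ∈ N := by
  induction n with
  | zero => exact absurd h h1
  | succ n ih =>
    by_cases hn : twistedPow φ e n ∈ N
    · exact ih hn
    · exact ⟨n, hn, h⟩

/-- A Levitzki-type argument: among the elements of I outside N, take a with maximal left
annihilator modulo N, and deduce a R σ^k(a) ⊆ N from the place where the twisted powers of a u enter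
N. -/
theorem le_nilRadical_of_left_noetherian [IsNoetherian R R] (σ : R ≃+* R) {I : Ideal R}
    [I.IsTwoSided] (h : ∀ a ∈ I, ∀ k, 1 ≤ k → ∃ n, twistedPow σ^[k] a n = 0) :
    I ≤ nilRadical R := by
  set N := nilRadical R
  by_contra hle
  obtain ⟨b, hb, hbN⟩ := SetLike.not_le_iff_exists.1 hle
  let ann : R → Ideal R := fun a => Submodule.comap (LinearMap.toSpanSingleton R R a) N
  have hann : ∀ a r, r ∈ ann a ↔ r * a ∈ N := fun a r => Iff.rfl
  obtain ⟨_, ⟨a, ⟨haI, haN⟩, rfl⟩, hmax⟩ := set_has_maximal_iff_noetherian.2 ‹IsNoetherian R R›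
    (ann '' {a | a ∈ I ∧ a ∉ N}) ⟨_, b, ⟨hb, hbN⟩, rfl⟩
  have hmax' : ∀ w, a * w ∉ N → ∀ r, r * (a * w) ∈ N → r * a ∈ N := by
    intro w hw r hr
    by_contra hra
    refine hmax (ann (a * w)) ⟨_, ⟨I.mul_mem_right w haI, hw⟩, rfl⟩ ?_
    refine SetLike.lt_iff_le_and_exists.2 ⟨fun s hs => ?_, r, hr, hra⟩
    rw [hann, ← mul_assoc]
    exact N.mul_mem_right w hs
  refine haN (mem_nilRadical_of_forall_mul_iterate_mem R (fun s x => Or.inl ⟨s, rfl⟩) σ ?_)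
  intro k hk u
  obtain ⟨n, hn⟩ := h _ (I.mul_mem_right u haI) k hk
  obtain ⟨m, hm, hm'⟩ := exists_twistedPow_boundary (N := N) (hn ▸ zero_mem N)
    fun h1 => haN (by simpa using N.mul_mem_left a h1)
  cases m with
  | zero =>
    have : a * u ∈ N := by
      simp only [twistedPow, iterate_map_one, mul_one] at hm'
      exact hm'
    exact N.mul_mem_right _ this
  | succ m =>
    -- The last product outside N has the form a w, and the next one is σ^k(s a w). Maximality
    -- removes w, so s a ∈ N, and σ^k(s a) = a u σ^k(a).
    obtain ⟨s, hs⟩ := σ.surjective.iterate k (a * u)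
    have hsucc : twistedPow σ^[k] (a * u) (m + 1 + 1) =
        σ^[k] (s * twistedPow σ^[k] (a * u) (m + 1)) := by
      rw [iterate_map_mul, hs, ← twistedPow.eq_2]
    rw [hsucc, iterate_mem_nilRadical_iff, twistedPow, mul_assoc a] at hm'
    rw [twistedPow, mul_assoc a] at hm
    have := hmax' _ hm s hm'
    rw [← hs, ← iterate_map_mul]
    exact (iterate_mem_nilRadical_iff σ k).2 this

/-- Mirror image, with right annihilators modulo N and twisted powers of u a. -/
theorem le_nilRadical_of_right_noetherian [IsNoetherian Rᵐᵒᵖ R] (σ : R ≃+* R) {I : Ideal R}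
    (h : ∀ a ∈ I, ∀ k, 1 ≤ k → ∃ n, twistedPow σ^[k] a n = 0) :
    I ≤ nilRadical R := by
  set N := nilRadical R
  by_contra hle
  obtain ⟨b, hb, hbN⟩ := SetLike.not_le_iff_exists.1 hle
  let ann : R → Submodule Rᵐᵒᵖ R := fun a =>
    { carrier := {r | a * r ∈ N}
      add_mem' := fun {x y} hx hy => by
        simp only [Set.mem_ofPred_eq, mul_add] at *
        exact add_mem hx hy
      zero_mem' := by simp
      smul_mem' := fun c x hx => by
        simp only [Set.mem_ofPred_eq, MulOpposite.smul_eq_mul_unop, ← mul_assoc] at *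
        exact N.mul_mem_right _ hx }
  obtain ⟨_, ⟨a, ⟨haI, haN⟩, rfl⟩, hmax⟩ := set_has_maximal_iff_noetherian.2 ‹IsNoetherian Rᵐᵒᵖ R›
    (ann '' {a | a ∈ I ∧ a ∉ N}) ⟨_, b, ⟨hb, hbN⟩, rfl⟩
  have hmax' : ∀ w, w * a ∉ N → ∀ r, w * a * r ∈ N → a * r ∈ N := by
    intro w hw r hr
    by_contra hra
    refine hmax (ann (w * a)) ⟨_, ⟨I.mul_mem_left w haI, hw⟩, rfl⟩ ?_
    refine SetLike.lt_iff_le_and_exists.2 ⟨fun s hs => ?_, r, hr, hra⟩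
    change w * a * s ∈ N
    rw [mul_assoc]
    exact N.mul_mem_left w hs
  refine haN (mem_nilRadical_of_forall_mul_iterate_mem Rᵐᵒᵖ (fun s x => Or.inr ⟨s.unop, rfl⟩) σ ?_)
  intro k hk t
  obtain ⟨u, rfl⟩ := σ.surjective.iterate k t
  obtain ⟨n, hn⟩ := h _ (I.mul_mem_left u haI) k hk
  obtain ⟨m, hm, hm'⟩ := exists_twistedPow_boundary (N := N) (hn ▸ zero_mem N)
    fun h1 => haN (by simpa using N.mul_mem_left a h1)
  rw [mul_assoc, ← iterate_map_mul]
  cases m with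
  | zero =>
    have : u * a ∈ N := by
      simp only [twistedPow, iterate_map_one, mul_one] at hm'
      exact hm'
    exact N.mul_mem_left _ ((iterate_mem_nilRadical_iff σ k).2 this)
  | succ m =>
    -- After undoing σ^{km}, the two consecutive products are s u a ∉ N and s u a σ^k(u a) ∈ N;
    -- maximality removes the factor s u.
    obtain ⟨s, hs⟩ := σ.surjective.iterate (k * m) (twistedPow σ^[k] (u * a) m)
    rw [twistedPow_succ', ← hs, ← iterate_map_mul, iterate_mem_nilRadical_iff,
      ← mul_assoc] at hm
    rw [twistedPow_succ', twistedPow_succ', ← hs, ← iterate_map_mul, Nat.mul_succ,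
      Function.iterate_add_apply, ← iterate_map_mul, iterate_mem_nilRadical_iff,
      ← mul_assoc] at hm'
    exact hmax' _ hm _ hm'

/-- Choosing k with σ^k(a) = a turns twisted powers into ordinary ones. -/
theorem le_nilRadical_of_isLocallyFiniteOrder {σ : R ≃+* R} (hσ : IsLocallyFiniteOrder σ)
    {I : Ideal R} [I.IsTwoSided] (h : ∀ a ∈ I, ∀ k, 1 ≤ k → ∃ n, twistedPow σ^[k] a n = 0) :
    I ≤ nilRadical R := by
  refine le_nilRadical fun a ha => ?_
  obtain ⟨k, hk, hka⟩ := hσ a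
  obtain ⟨n, hn⟩ := h a ha k hk
  refine ⟨n, ?_⟩
  rw [← hn, twistedPow_of_fixed fun m => by rw [iterate_map_pow, hka]]

end NilRadical
-- Constants of the maximal right ideals that avoid x.
namespace SkewPoly

variable {R : Type*} [Ring R] {σ : R ≃+* R}

/-- `Q` is the set of constants of a maximal right ideal of `R[x;σ]` that does not contain `x`. -/
def IsConstantsOfMaximal (σ : R ≃+* R) (Q : Ideal R) : Prop :=
  ∃ M : Submodule (SkewPoly R σ)ᵐᵒᵖ (SkewPoly R σ),
    IsCoatom M ∧ X σ ∉ M ∧ ∀ r, r ∈ Q ↔ C σ r ∈ M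

theorem exists_isConstantsOfMaximal (hT : IsRightQuasiDuo (SkewPoly R σ))
    {M : Submodule (SkewPoly R σ)ᵐᵒᵖ (SkewPoly R σ)} (hM : IsCoatom M) (hX : X σ ∉ M) :
    ∃ Q, IsConstantsOfMaximal σ Q ∧ ∀ r, r ∈ Q ↔ C σ r ∈ M :=
  let Q : Ideal R :=
    { carrier := {r | C σ r ∈ M}
      add_mem' := fun {x y} hx hy => by
        simp only [Set.mem_ofPred_eq, map_add] at *
        exact add_mem hx hy
      zero_mem' := by simp
      smul_mem' := fun c x hx => by
        simp only [Set.mem_ofPred_eq, smul_eq_mul, map_mul] at *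
        exact hT M hM _ _ hx }
  ⟨Q, ⟨M, hM, hX, fun _ => Iff.rfl⟩, fun _ => Iff.rfl⟩

namespace IsConstantsOfMaximal

variable {Q : Ideal R}

theorem isTwoSided (hQ : IsConstantsOfMaximal σ Q) : Q.IsTwoSided := by
  obtain ⟨M, hM, hX, h⟩ := hQ
  refine ⟨fun {a} b ha => ?_⟩
  rw [h, map_mul]
  exact mul_mem_of_mem_right_ideal M ((h a).1 ha) _

theorem mem_or_mem (hT : IsRightQuasiDuo (SkewPoly R σ)) (hQ : IsConstantsOfMaximal σ Q)
    {a b : R} (hab : a * b ∈ Q) : a ∈ Q ∨ b ∈ Q := by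
  obtain ⟨M, hM, hX, h⟩ := hQ
  rw [h, map_mul] at hab
  rw [h, h]
  exact hT.mem_or_mem hM hab

theorem mem_of_isNilpotent (hT : IsRightQuasiDuo (SkewPoly R σ)) (hQ : IsConstantsOfMaximal σ Q)
    {a : R} (ha : IsNilpotent a) : a ∈ Q := by
  obtain ⟨M, hM, hX, h⟩ := hQ
  exact (h a).2 (hT.mem_of_isNilpotent hM (ha.map (C σ)))

/-- In x a = σ(a) x the factor x cancels modulo M. -/
theorem map_mem_iff (hT : IsRightQuasiDuo (SkewPoly R σ)) (hQ : IsConstantsOfMaximal σ Q)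
    {a : R} : σ a ∈ Q ↔ a ∈ Q := by
  obtain ⟨M, hM, hX, h⟩ := hQ
  rw [h, h]
  constructor
  · intro ha
    have := mul_mem_of_mem_right_ideal M ha (X σ)
    rw [← X_mul_C] at this
    exact (hT.mem_or_mem hM this).resolve_left hX
  · intro ha
    have := hT M hM (X σ) _ ha
    rw [X_mul_C] at this
    exact (hT.mem_or_mem hM this).resolve_right hX

theorem iterate_mem_iff (hT : IsRightQuasiDuo (SkewPoly R σ)) (hQ : IsConstantsOfMaximal σ Q)
    (n : ℕ) {a : R} : σ^[n] a ∈ Q ↔ a ∈ Q := by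
  induction n with
  | zero => rfl
  | succ n ih => rw [Function.iterate_succ_apply', hQ.map_mem_iff hT, ih]

theorem exists_last_coeff_notMem (f : SkewPoly R σ) {n : ℕ} (hn : f.coeff n ∉ Q) :
    ∃ m, n ≤ m ∧ f.coeff m ∉ Q ∧ ∀ k, m < k → f.coeff k ∈ Q := by
  classical
  obtain ⟨N, hN⟩ := exists_coeff_eq_zero f
  have hb : ∀ k, f.coeff k ∉ Q → k ≤ N := fun k hk => by
    by_contra hlt
    exact hk (hN k (not_le.1 hlt).le ▸ zero_mem Q)
  refine ⟨Nat.findGreatest (fun k => f.coeff k ∉ Q) N, Nat.le_findGreatest (hb n hn) hn,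
    Nat.findGreatest_spec (P := fun k => f.coeff k ∉ Q) (hb n hn) hn, fun k hk => ?_⟩
  by_contra hkQ
  exact Nat.findGreatest_is_greatest hk (hb k hkQ) hkQ

/-- Degrees add in (R/Q)[x;σ], since R/Q is a domain on which σ is injective; a polynomial of
positive degree therefore has no right inverse. -/
theorem mul_sub_one_coeff_notMem (hT : IsRightQuasiDuo (SkewPoly R σ))
    (hQ : IsConstantsOfMaximal σ Q) {f : SkewPoly R σ} {n : ℕ} (hn : 1 ≤ n)
    (hf : f.coeff n ∉ Q) (g : SkewPoly R σ) : ∃ m, (f * g - 1).coeff m ∉ Q := by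
  have := hQ.isTwoSided
  by_contra! hfg
  obtain ⟨a, hna, ha, ha'⟩ := exists_last_coeff_notMem f hf
  by_cases hg : ∀ m, g.coeff m ∈ Q
  · have h0 := hfg 0
    rw [coeff_sub, coeff_mul, coeff_one, if_pos rfl] at h0
    have h1 : (1 : R) ∈ Q := by
      rw [← sub_sub_cancel (∑ p ∈ Finset.HasAntidiagonal.antidiagonal 0,
        f.coeff p.1 * σ^[p.1] (g.coeff p.2)) 1]
      exact sub_mem (sum_mem fun p _ => Q.mul_mem_left _ ((hQ.iterate_mem_iff hT _).2 (hg _))) h0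
    exact hf (by simpa using Q.mul_mem_left (f.coeff n) h1)
  · push Not at hg
    obtain ⟨m, hm⟩ := hg
    obtain ⟨b, -, hb, hb'⟩ := exists_last_coeff_notMem g hm
    have h := hfg (a + b)
    rw [coeff_sub, coeff_one, if_neg (by omega), sub_zero, coeff_mul,
      ← Finset.add_sum_erase _ _ (Finset.HasAntidiagonal.mem_antidiagonal.2 (by rfl) :
        (a, b) ∈ Finset.HasAntidiagonal.antidiagonal (a + b))] at h
    have hrest : ∑ p ∈ (Finset.HasAntidiagonal.antidiagonal (a + b)).erase (a, b),
        f.coeff p.1 * σ^[p.1] (g.coeff p.2) ∈ Q := by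
      refine sum_mem fun p hp => ?_
      obtain ⟨i, j⟩ := p
      rw [Finset.mem_erase, Finset.HasAntidiagonal.mem_antidiagonal] at hp
      obtain ⟨hne, hij⟩ := hp
      dsimp only at hij ⊢
      rcases lt_trichotomy i a with hi | rfl | hi
      · exact Q.mul_mem_left _ ((hQ.iterate_mem_iff hT _).2 (hb' j (by omega)))
      · exact absurd (by rw [Nat.add_left_cancel hij]) hne
      · exact Q.mul_mem_right _ (ha' i hi)
    rcases hQ.mem_or_mem hT ((add_mem_cancel_right hrest).1 h) with h | h
    · exact ha h
    · exact hb ((hQ.iterate_mem_iff hT _).1 h)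

/-- A skew polynomial that is not constant modulo `Q` lies in a maximal right ideal
containing `Q`. -/
theorem exists_isCoatom_mem (hT : IsRightQuasiDuo (SkewPoly R σ))
    (hQ : IsConstantsOfMaximal σ Q) {f : SkewPoly R σ} {n : ℕ} (hn : 1 ≤ n)
    (hf : f.coeff n ∉ Q) : ∃ M : Submodule (SkewPoly R σ)ᵐᵒᵖ (SkewPoly R σ),
      IsCoatom M ∧ f ∈ M ∧ ∀ r ∈ Q, C σ r ∈ M := by
  have := hQ.isTwoSided
  let W : Submodule (SkewPoly R σ)ᵐᵒᵖ (SkewPoly R σ) :=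
    { carrier := {p | ∀ n, p.coeff n ∈ Q}
      add_mem' := fun {p q} hp hq n => by
        rw [coeff_add]
        exact add_mem (hp n) (hq n)
      zero_mem' := fun n => by simp
      smul_mem' := fun c p hp n => by
        rw [MulOpposite.smul_eq_mul_unop, coeff_mul]
        exact sum_mem fun i _ => Q.mul_mem_right _ (hp _) }
  obtain ⟨M, hM, hle⟩ := exists_isCoatom_right_ideal_le
    (N := Submodule.span (SkewPoly R σ)ᵐᵒᵖ {f} ⊔ W) (by
      intro h1
      obtain ⟨p, hp, w, hw, hpw⟩ := Submodule.mem_sup.1 h1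
      obtain ⟨g, rfl⟩ := Submodule.mem_span_singleton.1 hp
      obtain ⟨m, hm⟩ := hQ.mul_sub_one_coeff_notMem hT hn hf g.unop
      refine hm ?_
      have : f * g.unop - 1 = -w := by rw [← hpw, MulOpposite.smul_eq_mul_unop]; abel
      rw [this, coeff_neg]
      exact neg_mem (hw m))
  refine ⟨M, hM, hle (Submodule.mem_sup_left (Submodule.mem_span_singleton_self f)),
    fun r hr => hle (Submodule.mem_sup_right fun m => ?_)⟩
  rw [C_apply, coeff_monomial]
  split
  · exact hr
  · exact zero_mem Q

/-- Q' comes from a maximal right ideal M containing 1 - c x. There c x ≡ 1, so M contains neither c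
nor x, and commuting y past 1 - c x leaves (c σ(y) - y c) x, from which x cancels. -/
theorem exists_twisted_commute (hT : IsRightQuasiDuo (SkewPoly R σ))
    (hQ : IsConstantsOfMaximal σ Q) {c : R} (hc : c ∉ Q) :
    ∃ Q', IsConstantsOfMaximal σ Q' ∧ Q ≤ Q' ∧ c ∉ Q' ∧ ∀ y, c * σ y - y * c ∈ Q' := by
  have hcoeff : (1 - C σ c * X σ).coeff 1 ∉ Q := by
    rw [coeff_sub, coeff_one, if_neg (by decide), zero_sub, ← zero_add 1, coeff_mul_X, C_apply,
      coeff_monomial, if_pos rfl, neg_mem_iff]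
    exact hc
  obtain ⟨M, hM, hcM, hQM⟩ := hQ.exists_isCoatom_mem hT le_rfl hcoeff
  have hone : C σ c * X σ ∉ M := fun h =>
    one_notMem_of_isCoatom hM (by simpa using add_mem hcM h)
  have hX : X σ ∉ M := fun h => hone (hT M hM _ _ h)
  obtain ⟨Q', hQ', hQM'⟩ := exists_isConstantsOfMaximal hT hM hX
  refine ⟨Q', hQ', fun r hr => (hQM' r).2 (hQM r hr), fun h => hone ?_, fun y => ?_⟩
  · exact mul_mem_of_mem_right_ideal M ((hQM' c).1 h) _
  · rw [hQM']
    refine (hT.mem_or_mem hM (b := X σ) ?_).resolve_right hX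
    have : C σ (c * σ y - y * c) * X σ =
        C σ y * (1 - C σ c * X σ) - (1 - C σ c * X σ) * C σ y := by
      simp only [map_sub, map_mul, sub_mul, mul_sub, mul_assoc, X_mul_C]
      noncomm_ring
    rw [this]
    exact sub_mem (hT M hM _ _ hcM) (mul_mem_of_mem_right_ideal M hcM _)

/-- Both a and g a intertwine σ with the identity modulo Q', so g is central there once a is
cancelled. -/
theorem exists_central (hT : IsRightQuasiDuo (SkewPoly R σ)) (hQ : IsConstantsOfMaximal σ Q)
    {a g : R} (ha : a ∉ Q) (hσ : ∀ y, a * σ y - y * a ∈ Q) (hg : g ∉ Q) :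
    ∃ Q', IsConstantsOfMaximal σ Q' ∧ Q ≤ Q' ∧ a ∉ Q' ∧ g ∉ Q' ∧ ∀ y, g * y - y * g ∈ Q' := by
  obtain ⟨Q', hQ', hle, hga, h⟩ := hQ.exists_twisted_commute hT
    (c := g * a) fun h => (hQ.mem_or_mem hT h).elim hg ha
  have := hQ'.isTwoSided
  have haQ' : a ∉ Q' := fun h => hga (Q'.mul_mem_left g h)
  refine ⟨Q', hQ', hle, haQ', fun h => hga (Q'.mul_mem_right a h), fun y => ?_⟩
  refine (hQ'.mem_or_mem hT (b := a) ?_).resolve_right haQ'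
  have : (g * y - y * g) * a = (g * a * σ y - y * (g * a)) - g * (a * σ y - y * a) := by
    noncomm_ring
  rw [this]
  exact sub_mem (h y) (Q'.mul_mem_left g (hle (hσ y)))

theorem commutator_mem_of_twisted_commute (hT : IsRightQuasiDuo (SkewPoly R σ))
    (hQ : IsConstantsOfMaximal σ Q) {a : R} (ha : a ∉ Q) (hσ : ∀ y, a * σ y - y * a ∈ Q)
    (u v : R) : u * v - v * u ∈ Q := by
  by_contra h₀
  obtain ⟨Q₁, hQ₁, hle₁, ha₁, h₁, hc₁⟩ := hQ.exists_central hT ha hσ h₀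
  have := hQ₁.isTwoSided
  have hu₁ : u ∉ Q₁ := fun hu => h₁ (sub_mem (Q₁.mul_mem_right v hu) (Q₁.mul_mem_left v hu))
  -- With h = u v - v u already central, making u h central as well forces h² = [u h, v] - u [h, v]
  -- to vanish modulo Q₂, contradicting u h ∉ Q₂.
  obtain ⟨Q₂, hQ₂, hle₂, ha₂, h₂, hc₂⟩ := hQ₁.exists_central hT ha₁ (fun y => hle₁ (hσ y))
    (g := u * (u * v - v * u)) fun h => (hQ₁.mem_or_mem hT h).elim hu₁ h₁
  set h := u * v - v * u with h_def
  have hsq : h * h ∈ Q₂ := by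
    have : h * h = (u * h * v - v * (u * h)) - u * (h * v - v * h) := by
      rw [h_def]
      noncomm_ring
    rw [this]
    exact sub_mem (hc₂ v) (Q₂.mul_mem_left u (hle₂ (hc₁ v)))
  exact h₂ (Q₂.mul_mem_left u ((hQ₂.mem_or_mem hT hsq).elim id id))

theorem commutator_mem (hT : IsRightQuasiDuo (SkewPoly R σ)) (hQ : IsConstantsOfMaximal σ Q)
    (u v : R) : u * v - v * u ∈ Q := by
  by_contra hc
  obtain ⟨Q', hQ', -, hc', h⟩ := hQ.exists_twisted_commute hT hc
  exact hc' (hQ'.commutator_mem_of_twisted_commute hT hc' h u v)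

theorem map_sub_mem (hT : IsRightQuasiDuo (SkewPoly R σ)) (hQ : IsConstantsOfMaximal σ Q)
    (y : R) : σ y - y ∈ Q := by
  by_contra hc
  obtain ⟨Q', hQ', -, hc', h⟩ := hQ.exists_twisted_commute hT hc
  refine hc' ((hQ'.mem_or_mem hT (a := σ y - y) ?_).elim id id)
  -- With c = σ(y) - y, the twisted commutator of c and y differs from the ordinary one by c².
  have : (σ y - y) * (σ y - y) = ((σ y - y) * σ y - y * (σ y - y)) -
      ((σ y - y) * y - y * (σ y - y)) := by noncomm_ring
  rw [this]
  exact sub_mem (h y) (hQ'.commutator_mem hT _ y)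

end IsConstantsOfMaximal

/-! ### The intersection of the ideals of constants, and the Jacobson radical. -/

theorem isTwoSided_sInf_constants (σ : R ≃+* R) :
    (sInf {Q | IsConstantsOfMaximal σ Q}).IsTwoSided := by
  refine ⟨fun {a} b ha => ?_⟩
  rw [Submodule.mem_sInf] at ha ⊢
  intro (Q : Ideal R) hQ
  have := IsConstantsOfMaximal.isTwoSided hQ
  exact Q.mul_mem_right b (ha Q hQ)

/-- The equation g = 1 + a x^k g is a recursion for the coefficients of g. -/
theorem coeff_right_inverse_one_sub {a : R} {k : ℕ} (hk : 1 ≤ k) {g : SkewPoly R σ}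
    (hg : (1 - C σ a * X σ ^ k) * g = 1) (n : ℕ) :
    g.coeff (k * n) = twistedPow σ^[k] a n := by
  have hg' : g = 1 + monomial σ k a * g := by
    rw [← C_mul_X_pow]
    nth_rw 1 [← sub_add_cancel g (C σ a * X σ ^ k * g)]
    rw [← hg]
    noncomm_ring
  have hcoeff : ∀ m, (monomial σ k a * g).coeff (k + m) = a * σ^[k] (g.coeff m) := by
    intro m
    rw [coeff_mul, Finset.sum_eq_single (k, m)]
    · simp [coeff_monomial]
    · rintro ⟨p, q⟩ hpq hne
      rw [Finset.HasAntidiagonal.mem_antidiagonal] at hpq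
      have : k ≠ p := fun hp => hne (by ext <;> simp at hpq ⊢ <;> omega)
      simp [coeff_monomial, this]
    · intro hn
      exact absurd (Finset.HasAntidiagonal.mem_antidiagonal.2 (by rfl)) hn
  induction n with
  | zero =>
    rw [hg', coeff_add, coeff_one, mul_zero, if_pos rfl, coeff_mul]
    have : k ≠ 0 := by omega
    simp [coeff_monomial, this, twistedPow]
  | succ n ih =>
    rw [hg', Nat.mul_succ, add_comm (k * n), coeff_add, coeff_one, if_neg (by omega), zero_add, hcoeff, ih,
      twistedPow]

/-- Every maximal right ideal contains a x^k, through x or through a, so 1 - a x^k has a right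
inverse; that inverse has finitely many coefficients. -/
theorem exists_twistedPow_eq_zero (hT : IsRightQuasiDuo (SkewPoly R σ)) {a : R}
    (ha : a ∈ sInf {Q | IsConstantsOfMaximal σ Q}) {k : ℕ} (hk : 1 ≤ k) :
    ∃ n, twistedPow σ^[k] a n = 0 := by
  obtain ⟨g, hg⟩ := exists_right_inverse_of_forall_notMem (a := 1 - C σ a * X σ ^ k) (by
    intro M hM h
    refine one_notMem_of_isCoatom hM ?_
    have hmem : C σ a * X σ ^ k ∈ M := by
      by_cases hX : X σ ∈ M
      · obtain ⟨l, rfl⟩ := Nat.exists_eq_add_of_le' hk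
        rw [pow_succ]
        exact hT M hM _ _ (hT M hM _ _ hX)
      · obtain ⟨Q, hQ, hQM⟩ := exists_isConstantsOfMaximal hT hM hX
        exact mul_mem_of_mem_right_ideal M ((hQM a).1 (Submodule.mem_sInf.1 ha Q hQ)) _
    simpa using add_mem h hmem)
  obtain ⟨N, hN⟩ := exists_coeff_eq_zero g
  exact ⟨N, by
    rw [← coeff_right_inverse_one_sub hk hg]; exact hN _ (Nat.le_mul_of_pos_left N hk)⟩

theorem jacobson_eq_withCoeffsIn (hT : IsRightQuasiDuo (SkewPoly R σ))
    (hI : sInf {Q | IsConstantsOfMaximal σ Q} ≤ nilRadical R) :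
    (Ring.jacobson (SkewPoly R σ) : Set (SkewPoly R σ)) = withCoeffsIn σ (nilRadical R) := by
  ext f
  constructor
  · intro hf n
    refine hI (Submodule.mem_sInf.2 fun Q hQ => ?_)
    by_contra hn
    -- Multiplying by x moves the coefficient to positive degree, so that n = 0 is covered too.
    have hcoeff : (1 - f * X σ).coeff (n + 1) ∉ Q := by
      rw [coeff_sub, coeff_one, if_neg (by omega), zero_sub, coeff_mul_X, neg_mem_iff]
      exact hn
    obtain ⟨M, hM, h, -⟩ :=
      IsConstantsOfMaximal.exists_isCoatom_mem hT hQ (Nat.le_add_left 1 n) hcoeff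
    have hfM := mem_jacobson_iff_forall_right_ideal.1 hf M hM
    exact one_notMem_of_isCoatom hM (by
      simpa using add_mem h (mul_mem_of_mem_right_ideal M hfM (X σ)))
  · intro hf
    refine mem_jacobson_iff_forall_right_ideal.2 fun M hM => mem_of_coeff_mem fun n => ?_
    exact hT.mem_of_isNilpotent hM ((isNilpotent_of_mem_nilRadical (hf n)).map (C σ))

theorem iterate_sub_mem {I : Ideal R} (h : ∀ y, σ y - y ∈ I) (n : ℕ) (y : R) :
    σ^[n] y - y ∈ I := by
  induction n with
  | zero => simp
  | succ n ih =>
    rw [Function.iterate_succ_apply', ← sub_add_sub_cancel _ (σ^[n] y)]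
    exact add_mem (h _) ih

theorem commutator_mem_withCoeffsIn {I : Ideal R} [I.IsTwoSided]
    (hcomm : ∀ u v : R, u * v - v * u ∈ I) (hσ : ∀ y, σ y - y ∈ I) (f g : SkewPoly R σ) :
    f * g - g * f ∈ withCoeffsIn σ I := by
  intro n
  have hswap : (g * f).coeff n = ∑ p ∈ Finset.HasAntidiagonal.antidiagonal n,
      g.coeff p.2 * σ^[p.2] (f.coeff p.1) := by
    rw [coeff_mul]
    exact Finset.sum_equiv (Equiv.prodComm ℕ ℕ)
      (fun p => by simp [Finset.HasAntidiagonal.mem_antidiagonal, add_comm]) fun p _ => rfl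
  rw [coeff_sub, hswap, coeff_mul, ← Finset.sum_sub_distrib]
  refine sum_mem fun p _ => ?_
  have : f.coeff p.1 * σ^[p.1] (g.coeff p.2) - g.coeff p.2 * σ^[p.2] (f.coeff p.1) =
      f.coeff p.1 * (σ^[p.1] (g.coeff p.2) - g.coeff p.2) +
        (f.coeff p.1 * g.coeff p.2 - g.coeff p.2 * f.coeff p.1) -
          g.coeff p.2 * (σ^[p.2] (f.coeff p.1) - f.coeff p.1) := by noncomm_ring
  rw [this]
  exact sub_mem (add_mem (I.mul_mem_left _ (iterate_sub_mem hσ _ _)) (hcomm _ _))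
    (I.mul_mem_left _ (iterate_sub_mem hσ _ _))

end SkewPoly

/-! ### The converse and the main theorem. -/

open SkewPoly in
-- Modulo J(T) the ring is commutative, and every maximal right ideal contains J(T).
theorem isRightQuasiDuo_of_jacobson_eq {R : Type*} [Ring R] {σ : R ≃+* R} {I : Ideal R}
    [I.IsTwoSided]
    (hJ : (Ring.jacobson (SkewPoly R σ) : Set (SkewPoly R σ)) = withCoeffsIn σ I)
    (hcomm : ∀ u v : R, u * v - v * u ∈ I) (hσ : ∀ y, σ y - y ∈ I) :
    IsRightQuasiDuo (SkewPoly R σ) := by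
  intro M hM t a ha
  have h : t * a - a * t ∈ (Ring.jacobson (SkewPoly R σ) : Set (SkewPoly R σ)) :=
    hJ ▸ commutator_mem_withCoeffsIn hcomm hσ t a
  simpa using add_mem (mem_jacobson_iff_forall_right_ideal.1 h M hM)
    (mul_mem_of_mem_right_ideal M ha t)

theorem commutator_mem_iff_quotient_comm {R : Type*} [Ring R] {I : Ideal R} [I.IsTwoSided] :
    (∀ a b : R ⧸ I, a * b = b * a) ↔ ∀ u v : R, u * v - v * u ∈ I := by
  simp only [Ideal.Quotient.mk_surjective.forall, ← map_mul, Ideal.Quotient.mk_eq_mk_iff_sub_mem]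

theorem nilRadicalQuotientAut_eq_refl_iff {R : Type*} [Ring R] {σ : R ≃+* R} :
    nilRadicalQuotientAut σ = RingEquiv.refl (R ⧸ nilRadical R) ↔
      ∀ y, σ y - y ∈ nilRadical R := by
  rw [RingEquiv.ext_iff, Ideal.Quotient.mk_surjective.forall]
  refine forall_congr' fun y => ?_
  rw [← Ideal.Quotient.mk_eq_mk_iff_sub_mem]
  rfl

theorem mainTheorem6 {R : Type*} [Ring R] (σ : R ≃+* R)
    (h : (IsNoetherian R R ∨ IsNoetherian Rᵐᵒᵖ R) ∨ IsLocallyFiniteOrder σ) :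
    IsRightQuasiDuo (SkewPoly R σ) ↔
      (Ring.jacobson (SkewPoly R σ) : Set (SkewPoly R σ)) =
          SkewPoly.withCoeffsIn σ (nilRadical R) ∧
        (∀ a b : R ⧸ nilRadical R, a * b = b * a) ∧
        nilRadicalQuotientAut σ = RingEquiv.refl (R ⧸ nilRadical R) := by
  rw [commutator_mem_iff_quotient_comm, nilRadicalQuotientAut_eq_refl_iff]
  constructor
  · intro hT
    have := SkewPoly.isTwoSided_sInf_constants σ
    have hnil := fun a ha k hk => SkewPoly.exists_twistedPow_eq_zero hT (a := a) ha (k := k) hk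
    have hI : sInf {Q | SkewPoly.IsConstantsOfMaximal σ Q} ≤ nilRadical R := by
      obtain (hl | hr) | hσ := h
      · exact le_nilRadical_of_left_noetherian σ hnil
      · exact le_nilRadical_of_right_noetherian σ hnil
      · exact le_nilRadical_of_isLocallyFiniteOrder hσ hnil
    exact ⟨SkewPoly.jacobson_eq_withCoeffsIn hT hI,
      fun u v => hI (Submodule.mem_sInf.2 fun Q hQ => hQ.commutator_mem hT u v),
      fun y => hI (Submodule.mem_sInf.2 fun Q hQ => hQ.map_sub_mem hT y)⟩
  · rintro ⟨hJ, hcomm, hσ⟩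
    exact isRightQuasiDuo_of_jacobson_eq hJ hcomm hσ
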